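/- Degree-one moment/Hankel bridge. Let $x_{t+1}=Ax_t+Bu_t$, $y_t=Cx_t+Du_t$ be a real linear time-invariant system with $x_t\in\mathbb R^{n_x}$, $u_t\in\mathbb R^{n_u}$, $y_t\in\mathbb R^{n_y}$, and assume that it is controllable (every state can be steered to every state in finite time). Write $w_t=(u_t,y_t)$, and for $L\in\mathbb N$ let $\mathcal B_L\subseteq\mathcal W_L:=(\mathbb R^{n_u+n_y})^L$ be the set of all $(w_0,\dots,w_{L-1})$ for which there are states $x_0,\dots,x_L$ satisfying the system equations for $t=0,\dots,L-1$. Let $n$ be the McMillan degree of the system (the least state dimension of a realization of its transfer function), and let $\bar n\ge n$ be an integer (for instance $\bar n=n$). Let $w^d=(u^d,y^d)\in\mathcal B_N$ be a trajectory of length $N$ of the system whose input $u^d$ is persistently exciting of order $L+\bar n$, i.e. the block Hankel matrix of depth $L+\bar n$ of $u^d$ has full row rank $(L+\bar n)n_u$. Let $H_L(w^d)\in\mathbb R^{L(n_u+n_y)\times(N-L+1)}$ be the block Hankel matrix whose columns are the consecutive length-$L$ windows of $w^d$, and let $\operatorname{col}H_L(w^d)$ be its column space. Let $\mathcal P_1(\mathcal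 B_L)$ be the set of Borel probability measures $\mu$ on $\mathcal W_L$ with $\mu(\mathcal B_L)=1$ and $\int\|w\|\,d\mu(w)<\infty$, and put $m_1(\mu):=\begin{bmatrix}1\\ \int w\,d\mu(w)\end{bmatrix}$. Then $$\{m_1(\mu):\mu\in\mathcal P_1(\mathcal B_L)\}=\operatorname{aff}\{m_1(\mu):\mu\in\mathcal P_1(\mathcal B_L)\}=\left\{\begin{bmatrix}1\\ H_L(w^d)g\end{bmatrix}:g\in\mathbb R^{N-L+1}\right\}=\{1\}\times\operatorname{col}H_L(w^d).$$ (If $N<L$, the matrix $H_L(w^d)$ has no columns and $\operatorname{col}H_L(w^d)=\{0\}$.) -/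

import Mathlib

open MeasureTheory
open scoped Matrix

/-- The data `(A, B, C, D)` of a discrete-time linear time-invariant system
`x (t+1) = A x t + B u t`, `y t = C x t + D u t`, with `nx` states, `nu` inputs, `ny` outputs. -/
structure LTISystem (nx nu ny : ℕ) where
  A : Matrix (Fin nx) (Fin nx) ℝ
  B : Matrix (Fin nx) (Fin nu) ℝ
  C : Matrix (Fin ny) (Fin nx) ℝ
  D : Matrix (Fin ny) (Fin nu) ℝ

/-- External trajectories of length `L`: the space `(ℝ^(nu+ny))^L`. The value of the signal
`w_t = (u_t, y_t)` is `w (t, ·)`: inputs sit at `Sum.inl`, outputs at `Sum.inr`. -/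
abbrev ExtTraj (nu ny L : ℕ) : Type := Fin L × (Fin nu ⊕ Fin ny) → ℝ

/-- The input component of an external trajectory. -/
def ExtTraj.input {nu ny L : ℕ} (w : ExtTraj nu ny L) : Fin L × Fin nu → ℝ :=
  fun p => w (p.1, Sum.inl p.2)

/-- The output component of an external trajectory. -/
def ExtTraj.output {nu ny L : ℕ} (w : ExtTraj nu ny L) : Fin L × Fin ny → ℝ :=
  fun p => w (p.1, Sum.inr p.2)

namespace LTISystem

variable {nx nu ny : ℕ}

/-- Controllability: every state can be steered to every state in finite time. -/
def IsControllable (S : LTISystem nx nu ny) : Prop :=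
  ∀ a b : Fin nx → ℝ, ∃ (T : ℕ) (x : Fin (T + 1) → Fin nx → ℝ) (u : Fin T → Fin nu → ℝ),
    x 0 = a ∧ x (Fin.last T) = b ∧
      ∀ t : Fin T, x t.succ = S.A *ᵥ x t.castSucc + S.B *ᵥ u t

/-- The finite-horizon external behavior: all input/output trajectories of length `L` that
are compatible with the system equations for some state trajectory (free initial state). -/
def behavior (S : LTISystem nx nu ny) (L : ℕ) : Set (ExtTraj nu ny L) :=
  {w | ∃ x : Fin (L + 1) → Fin nx → ℝ, ∀ t : Fin L,
    x t.succ = S.A *ᵥ x t.castSucc + S.B *ᵥ (fun i => ExtTraj.input w (t, i)) ∧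
    (fun i => ExtTraj.output w (t, i)) =
      S.C *ᵥ x t.castSucc + S.D *ᵥ (fun i => ExtTraj.input w (t, i))}

/-- `S'` realizes the input/output map (transfer function) of `S`: the Markov parameters
`D, CB, CAB, CA²B, …` agree. -/
def Realizes {k : ℕ} (S' : LTISystem k nu ny) (S : LTISystem nx nu ny) : Prop :=
  S'.D = S.D ∧ ∀ i : ℕ, S'.C * S'.A ^ i * S'.B = S.C * S.A ^ i * S.B

/-- The McMillan degree: the least state dimension of a realization. -/
noncomputable def mcMillanDegree (S : LTISystem nx nu ny) : ℕ :=
  sInf {k : ℕ | ∃ S' : LTISystem k nu ny, S'.Realizes S}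

/-- Borel probability measures on the trajectory space that are supported on the behavior
and have finite first moment (all norms on this space are equivalent). -/
def finiteFirstMomentMeasures (S : LTISystem nx nu ny) (L : ℕ) :
    Set (Measure (ExtTraj nu ny L)) :=
  {μ | IsProbabilityMeasure μ ∧ μ (S.behavior L) = 1 ∧ ∫⁻ w, ‖w‖ₑ ∂μ < ⊤}

end LTISystem

/-- The degree-one moment vector `[1; ∫ w dμ]`. -/
noncomputable def degreeOneMoment {nu ny L : ℕ} (μ : Measure (ExtTraj nu ny L)) :
    ℝ × ExtTraj nu ny L :=
  (1, ∫ w, w ∂μ)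

/-- The set of degree-one moment vectors of all finite-first-moment behavioral measures. -/
def LTISystem.degreeOneMomentSet {nx nu ny : ℕ} (S : LTISystem nx nu ny) (L : ℕ) :
    Set (ℝ × ExtTraj nu ny L) :=
  degreeOneMoment '' S.finiteFirstMomentMeasures L

/-- The depth-`L` block Hankel matrix of a signal of length `N` with channels `q`. Its
`N - L + 1` columns (none if `N < L`) are the consecutive length-`L` windows of the signal. -/
def blockHankel {q : Type} {N : ℕ} (L : ℕ) (w : Fin N × q → ℝ) :
    Matrix (Fin L × q) (Fin (N + 1 - L)) ℝ :=
  Matrix.of fun p j => w (⟨p.1.val + j.val, by omega⟩, p.2)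

/-- Persistency of excitation of order `k`: the depth-`k` Hankel matrix has full row rank. -/
def PersistentlyExciting {m N : ℕ} (u : Fin N × Fin m → ℝ) (k : ℕ) : Prop :=
  (blockHankel k u).rank = k * m

/-- The column space of a matrix: the linear span of its columns. -/
def columnSpace {ι κ : Type} (M : Matrix ι κ ℝ) : Submodule ℝ (ι → ℝ) :=
  Submodule.span ℝ (Set.range M.col)

/-! The behavior is a finite-dimensional subspace, hence closed and convex: it contains the mean of
every measure carried by it, and Dirac masses realize each of its points. So the moment set is {1} ×
behavior, already affine, and what remains is Willems' fundamental lemma: the behavior is the column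
space of the data Hankel matrix.

One inclusion is time invariance. For the other, states are replaced by their free responses, which
discards unobservable directions and leaves a controllable recursion of dimension at most the
McMillan degree. There `state_input_annihilator_eq_zero` shows that no nonzero functional kills all
state/input windows: Cayley–Hamilton eliminates the state from its time shifts, and excitation kills
the input functional that is left. Hence some combination of data windows matches any initial
response and input, and therefore the output. -/

/-! ### State/input windows of a persistently excited recursion -/

open Finset in
/-- A functional annihilating every state/input window of a controllable linear recursion with a
persistently exciting input is zero. -/
theorem state_input_annihilator_eq_zero {V U : Type*} [AddCommGroup V] [Module ℝ V]
    [FiniteDimensional ℝ V] [AddCommGroup U] [Module ℝ U]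
    (A : V →ₗ[ℝ] V) (B : U →ₗ[ℝ] V)
    (hctrl : ∀ ξ : V →ₗ[ℝ] ℝ, (∀ i : ℕ, ∀ u, ξ ((A ^ i) (B u)) = 0) → ξ = 0)
    {L n N : ℕ} (hdim : Module.finrank ℝ V ≤ n) (x : ℕ → V) (u : ℕ → U)
    (hx : ∀ t < N, x (t + 1) = A (x t) + B (u t))
    (hPE : ∀ η : ℕ → U →ₗ[ℝ] ℝ,
      (∀ j, j + (L + n) ≤ N → ∑ i ∈ range (L + n), η i (u (j + i)) = 0) →
        ∀ i < L + n, η i = 0)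
    (ξ : V →ₗ[ℝ] ℝ) (η : ℕ → U →ₗ[ℝ] ℝ)
    (h : ∀ j, j + L ≤ N → ξ (x j) + ∑ i ∈ range L, η i (u (j + i)) = 0) :
    ξ = 0 ∧ ∀ i < L, η i = 0 := by
  -- The power of `X` pads the characteristic polynomial to degree exactly `n`.
  obtain ⟨p, hmonic, hdeg, hpA⟩ : ∃ p : Polynomial ℝ, p.Monic ∧ p.natDegree = n ∧
      Polynomial.aeval A p = 0 := by
    refine ⟨Polynomial.X ^ (n - Module.finrank ℝ V) * A.charpoly,
      (Polynomial.monic_X_pow _).mul A.charpoly_monic, ?_, ?_⟩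
    · rw [(Polynomial.monic_X_pow _).natDegree_mul A.charpoly_monic,
        Polynomial.natDegree_X_pow, LinearMap.charpoly_natDegree]
      omega
    · rw [map_mul, LinearMap.aeval_self_charpoly, mul_zero]
  have hp : ∀ v, ∑ k ∈ range (n + 1), p.coeff k • (A ^ k) v = 0 := by
    intro v
    have := congrArg (fun f : Module.End ℝ V => f v) hpA
    simpa [Polynomial.aeval_eq_sum_range, hdeg, LinearMap.sum_apply] using this
  -- One sequence holds all unknowns: `η` reversed, followed by the functionals `ξ Aⁱ B`. With it,
  -- the relation shifted by `k` has input coefficients `d (k + L - 1 - i)`.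
  set d : ℕ → U →ₗ[ℝ] ℝ := fun m =>
    if m < L then η (L - 1 - m) else ξ ∘ₗ (A ^ (m - L)) ∘ₗ B with hd
  have hstate : ∀ k j, j + k ≤ N → x (j + k) = (A ^ k) (x j) +
      ∑ i ∈ range k, (A ^ (k - 1 - i)) (B (u (j + i))) := by
    intro k
    induction k with
    | zero => intro j _; simp
    | succ k ih =>
      intro j hj
      rw [← add_assoc, hx _ (by omega), ih j (by omega), map_add, map_sum, sum_range_succ,
        pow_succ', Module.End.mul_apply]
      have : ∀ i ∈ range k, A ((A ^ (k - 1 - i)) (B (u (j + i)))) =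
          (A ^ (k + 1 - 1 - i)) (B (u (j + i))) := by
        intro i hi
        have hi := mem_range.1 hi
        rw [show k + 1 - 1 - i = (k - 1 - i) + 1 by omega, pow_succ', Module.End.mul_apply]
      rw [sum_congr rfl this]
      simp [add_assoc]
  have hshift : ∀ k j, j + k + L ≤ N →
      ξ ((A ^ k) (x j)) + ∑ i ∈ range (k + L), d (k + L - 1 - i) (u (j + i)) = 0 := by
    intro k j hj
    rw [sum_range_add, ← h (j + k) hj, hstate k j (by omega), map_add, map_sum, add_assoc]
    congr 2
    · refine sum_congr rfl fun i hi => ?_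
      have hi := mem_range.1 hi
      simp only [hd]
      rw [if_neg (by omega), show k + L - 1 - i - L = k - 1 - i by omega]
      rfl
    · refine sum_congr rfl fun i hi => ?_
      have hi := mem_range.1 hi
      simp only [hd]
      rw [if_pos (by omega), show L - 1 - (k + L - 1 - (k + i)) = i by omega, add_assoc]
  -- Weighting the shifted relations by the coefficients of `p` cancels the state; `e` is the
  -- remaining input functional.
  set e : ℕ → U →ₗ[ℝ] ℝ := fun i => ∑ k ∈ range (n + 1),
    p.coeff k • (if i < k + L then d (k + L - 1 - i) else 0) with he
  have he0 : ∀ i < L + n, e i = 0 := by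
    refine hPE e fun j hj => ?_
    have h1 : ∑ k ∈ range (n + 1), p.coeff k * (ξ ((A ^ k) (x j)) +
        ∑ i ∈ range (k + L), d (k + L - 1 - i) (u (j + i))) = 0 :=
      sum_eq_zero fun k hk => by
        have hk := mem_range.1 hk
        rw [hshift k j (by omega), mul_zero]
    have h2 : ∑ k ∈ range (n + 1), p.coeff k * ξ ((A ^ k) (x j)) = 0 := by
      simpa using congrArg ξ (hp (x j))
    simp only [mul_add, sum_add_distrib, h2, zero_add] at h1
    rw [← h1]
    simp only [he, LinearMap.sum_apply, LinearMap.smul_apply, smul_eq_mul]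
    rw [sum_comm]
    refine sum_congr rfl fun k hk => ?_
    have hk := mem_range.1 hk
    rw [← mul_sum]
    congr 1
    rw [← sum_subset (s₁ := range (k + L)) (by intro a; simp only [mem_range]; omega)]
    · refine sum_congr rfl fun i hi => ?_
      rw [if_pos (mem_range.1 hi)]
    · intro i _ hi
      rw [if_neg (by simpa using hi), LinearMap.zero_apply]
  -- A linear recurrence for `d`, extended by zero to negative indices: early terms come from `e =
  -- 0`, late ones from Cayley–Hamilton. As `p` is monic, it forces `d = 0`.
  have hrec : ∀ m, ∑ k ∈ range (n + 1),
      p.coeff k • (if n ≤ k + m then d (k + m - n) else 0) = 0 := by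
    intro m
    by_cases hm : m < L + n
    · refine Eq.trans (sum_congr rfl fun k hk => ?_) (he0 (L + n - 1 - m) (by omega))
      by_cases hkm : n ≤ k + m
      · rw [if_pos hkm, if_pos (by omega),
          show k + L - 1 - (L + n - 1 - m) = k + m - n by omega]
      · rw [if_neg hkm, if_neg (by omega)]
    · ext v
      have := congrArg ξ (hp ((A ^ (m - n - L)) (B v)))
      rw [map_zero, map_sum] at this
      rw [LinearMap.sum_apply, LinearMap.zero_apply, ← this]
      refine sum_congr rfl fun k hk => ?_
      rw [if_pos (by omega)]
      simp only [hd]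
      rw [if_neg (by omega), show k + m - n - L = k + (m - n - L) by omega, pow_add]
      simp
  have hd0 : ∀ m, d m = 0 := by
    intro m
    induction m using Nat.strong_induction_on with
    | _ m ih =>
      have := hrec m
      rw [sum_range_succ, sum_eq_zero, zero_add, if_pos (by omega), ← hdeg, hmonic.coeff_natDegree,
        one_smul, Nat.add_sub_cancel_left] at this
      · exact this
      · intro k hk
        have hk := mem_range.1 hk
        split_ifs
        · rw [ih _ (by omega), smul_zero]
        · rw [smul_zero]
  refine ⟨hctrl ξ fun i v => ?_, fun i hi => ?_⟩
  · have := congrArg (fun f : U →ₗ[ℝ] ℝ => f v) (hd0 (L + i))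
    simpa [hd] using this
  · have := hd0 (L - 1 - i)
    simp only [hd] at this
    rwa [if_pos (by omega), show L - 1 - (L - 1 - i) = i by omega] at this

/-- Under the hypotheses of `state_input_annihilator_eq_zero`, the state/input windows span. -/
theorem exists_state_input_combination {V U : Type*} [AddCommGroup V] [Module ℝ V]
    [FiniteDimensional ℝ V] [AddCommGroup U] [Module ℝ U]
    (A : V →ₗ[ℝ] V) (B : U →ₗ[ℝ] V)
    (hctrl : ∀ ξ : V →ₗ[ℝ] ℝ, (∀ i : ℕ, ∀ u, ξ ((A ^ i) (B u)) = 0) → ξ = 0)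
    {L n N : ℕ} (hdim : Module.finrank ℝ V ≤ n) (x : ℕ → V) (u : ℕ → U)
    (hx : ∀ t < N, x (t + 1) = A (x t) + B (u t))
    (hPE : ∀ η : ℕ → U →ₗ[ℝ] ℝ,
      (∀ j, j + (L + n) ≤ N → ∑ i ∈ Finset.range (L + n), η i (u (j + i)) = 0) →
        ∀ i < L + n, η i = 0)
    (v : V) (r : Fin L → U) :
    ∃ g : Fin (N + 1 - L) → ℝ, ∑ j, g j • x j = v ∧
      ∀ i : Fin L, ∑ j : Fin (N + 1 - L), g j • u (j + i) = r i := by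
  let W : Fin (N + 1 - L) → V × (Fin L → U) := fun j => (x j, fun i => u (j + i))
  have htop : Submodule.span ℝ (Set.range W) = ⊤ := by
    by_contra hne
    obtain ⟨f, hf, hle⟩ := Submodule.exists_le_ker_of_lt_top _ (lt_top_iff_ne_top.2 hne)
    let η : ℕ → U →ₗ[ℝ] ℝ := fun i => if hi : i < L then
      f ∘ₗ LinearMap.inr ℝ V (Fin L → U) ∘ₗ LinearMap.single ℝ (fun _ => U) ⟨i, hi⟩ else 0
    have hηf : ∀ q : Fin L → U, f (0, q) = ∑ i : Fin L, η i (q i) := by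
      intro q
      have h1 : f (0, q) = (f ∘ₗ LinearMap.inr ℝ V (Fin L → U)) q := rfl
      rw [h1, ← Finset.univ_sum_single q, map_sum]
      refine Finset.sum_congr rfl fun i _ => ?_
      simp [η]
    have hsplit : ∀ a q, f (a, q) = f (a, 0) + f (0, q) := by
      intro a q
      rw [← map_add]
      simp
    obtain ⟨h1, h2⟩ := state_input_annihilator_eq_zero A B hctrl hdim x u hx hPE
      (f ∘ₗ LinearMap.inl ℝ V (Fin L → U)) η (by
        intro j hj
        have : f (W ⟨j, by omega⟩) = 0 := hle (Submodule.subset_span ⟨_, rfl⟩)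
        simp only [W] at this
        rw [hsplit, hηf] at this
        rw [Finset.sum_range]
        exact this)
    apply hf
    refine LinearMap.ext fun ⟨a, q⟩ => ?_
    have ha : f (a, 0) = 0 := congrArg (fun g : V →ₗ[ℝ] ℝ => g a) h1
    rw [hsplit, ha, hηf, zero_add, LinearMap.zero_apply]
    exact Finset.sum_eq_zero fun i _ => by rw [h2 i i.2, LinearMap.zero_apply]
  have hmem : (v, r) ∈ Submodule.span ℝ (Set.range W) := htop ▸ Submodule.mem_top
  obtain ⟨g, hg⟩ := (Submodule.mem_span_range_iff_exists_fun ℝ).1 hmem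
  refine ⟨g, ?_, fun i => ?_⟩
  · simpa [W, Prod.fst_sum] using congrArg Prod.fst hg
  · simpa [W, Prod.snd_sum] using congrFun (congrArg Prod.snd hg) i

/-! ### Hankel matrices and finite signals -/

/-- The sample at time `t` of a finite signal, extended by zero. -/
def signalAt {q : Type} {N : ℕ} (w : Fin N × q → ℝ) (t : ℕ) : q → ℝ :=
  fun i => if h : t < N then w (⟨t, h⟩, i) else 0

theorem signalAt_apply {q : Type} {N : ℕ} (w : Fin N × q → ℝ) {t : ℕ} (h : t < N) (i : q) :
    signalAt w t i = w (⟨t, h⟩, i) := dif_pos h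

theorem blockHankel_mulVec_apply {q : Type} {N L : ℕ} (w : Fin N × q → ℝ)
    (g : Fin (N + 1 - L) → ℝ) (p : Fin L × q) :
    (blockHankel L w *ᵥ g) p = ∑ j, g j * signalAt w (j + p.1) p.2 := by
  simp only [Matrix.mulVec, dotProduct]
  refine Finset.sum_congr rfl fun j _ => ?_
  rw [signalAt_apply w (by omega), mul_comm]
  simp [blockHankel, add_comm]

/-- The values of `η i` on unit vectors are the coefficients of a vanishing combination of the
Hankel rows, which full row rank makes independent. -/
theorem PersistentlyExciting.functional_eq_zero {m N k : ℕ} {u : Fin N × Fin m → ℝ}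
    (hu : PersistentlyExciting u k) (η : ℕ → (Fin m → ℝ) →ₗ[ℝ] ℝ)
    (h : ∀ j, j + k ≤ N → ∑ i ∈ Finset.range k, η i (signalAt u (j + i)) = 0) :
    ∀ i < k, η i = 0 := by
  have hli : LinearIndependent ℝ (blockHankel k u).row := by
    rw [linearIndependent_iff_card_eq_finrank_span, Set.finrank, ← Matrix.rank_eq_finrank_span_row,
      hu]
    simp
  have hcomb := Fintype.linearIndependent_iff.1 hli
    (fun p => η p.1 (Pi.single p.2 1)) (by
      ext j
      rw [Pi.zero_apply, ← h j (by omega), Finset.sum_range, Finset.sum_apply,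
        Fintype.sum_prod_type]
      refine Finset.sum_congr rfl fun i _ => ?_
      rw [LinearMap.pi_apply_eq_sum_univ (η i)]
      refine Finset.sum_congr rfl fun l _ => ?_
      rw [signalAt_apply u (by omega)]
      have hl : (fun l' => if l = l' then (1 : ℝ) else 0) = Pi.single l 1 := by
        ext l'
        simp [Pi.single_apply, eq_comm]
      rw [hl]
      simp [blockHankel, Matrix.row, add_comm, mul_comm])
  intro i hi
  refine LinearMap.pi_ext' fun l => LinearMap.ext_ring ?_
  simpa using hcomb (⟨i, hi⟩, l)

theorem mem_columnSpace_iff {ι κ : Type} [Fintype κ] (M : Matrix ι κ ℝ) (v : ι → ℝ) :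
    v ∈ columnSpace M ↔ ∃ g : κ → ℝ, v = M *ᵥ g := by
  rw [columnSpace, Submodule.mem_span_range_iff_exists_fun]
  simp only [Matrix.mulVec_eq_sum, op_smul_eq_smul, eq_comm (a := v)]
  rfl

/-! ### The behavior as a shift-invariant subspace -/

namespace LTISystem

variable {nx nu ny : ℕ}

/-- Trajectories described by state sequences indexed by all natural times. -/
theorem mem_behavior_iff (S : LTISystem nx nu ny) {L : ℕ} (w : ExtTraj nu ny L) :
    w ∈ S.behavior L ↔ ∃ x : ℕ → Fin nx → ℝ, ∀ t < L,
      x (t + 1) = S.A *ᵥ x t + S.B *ᵥ signalAt w.input t ∧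
      signalAt w.output t = S.C *ᵥ x t + S.D *ᵥ signalAt w.input t := by
  have hin : ∀ t : Fin L, signalAt w.input t = fun i => w.input (t, i) := fun t =>
    funext fun i => signalAt_apply _ t.2 i
  have hout : ∀ t : Fin L, signalAt w.output t = fun i => w.output (t, i) := fun t =>
    funext fun i => signalAt_apply _ t.2 i
  constructor
  · rintro ⟨x, hx⟩
    refine ⟨fun t => if h : t < L + 1 then x ⟨t, h⟩ else 0, fun t ht => ?_⟩
    have := hx ⟨t, ht⟩
    rw [← hin, ← hout] at this
    simp only [dif_pos (show t + 1 < L + 1 by omega), dif_pos (show t < L + 1 by omega)]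
    exact this
  · rintro ⟨x, hx⟩
    refine ⟨fun t => x t, fun t => ?_⟩
    have := hx t t.2
    rwa [hin, hout] at this

/-- The behavior as a linear subspace. -/
def behaviorSubmodule (S : LTISystem nx nu ny) (L : ℕ) : Submodule ℝ (ExtTraj nu ny L) where
  carrier := S.behavior L
  zero_mem' := ⟨0, fun t => by
    constructor <;> ext i <;> simp [ExtTraj.input, ExtTraj.output, Matrix.mulVec, dotProduct]⟩
  add_mem' := by
    rintro a b ⟨x, hx⟩ ⟨y, hy⟩
    refine ⟨x + y, fun t => ⟨?_, ?_⟩⟩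
    · have h1 : (fun i => ExtTraj.input (a + b) (t, i)) =
        (fun i => ExtTraj.input a (t, i)) + fun i => ExtTraj.input b (t, i) := rfl
      rw [h1, Pi.add_apply, Pi.add_apply, (hx t).1, (hy t).1]
      simp only [Matrix.mulVec_add]
      abel
    · have h1 : (fun i => ExtTraj.input (a + b) (t, i)) =
        (fun i => ExtTraj.input a (t, i)) + fun i => ExtTraj.input b (t, i) := rfl
      have h2 : (fun i => ExtTraj.output (a + b) (t, i)) =
        (fun i => ExtTraj.output a (t, i)) + fun i => ExtTraj.output b (t, i) := rfl
      rw [h1, h2, Pi.add_apply, (hx t).2, (hy t).2]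
      simp only [Matrix.mulVec_add]
      abel
  smul_mem' := by
    rintro c a ⟨x, hx⟩
    refine ⟨c • x, fun t => ⟨?_, ?_⟩⟩
    · have h1 : (fun i => ExtTraj.input (c • a) (t, i)) =
        c • (fun i => ExtTraj.input a (t, i)) := rfl
      rw [h1, Pi.smul_apply, Pi.smul_apply, (hx t).1]
      simp only [Matrix.mulVec_smul, smul_add]
    · have h1 : (fun i => ExtTraj.input (c • a) (t, i)) =
        c • (fun i => ExtTraj.input a (t, i)) := rfl
      have h2 : (fun i => ExtTraj.output (c • a) (t, i)) =
        c • (fun i => ExtTraj.output a (t, i)) := rfl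
      rw [h1, h2, Pi.smul_apply, (hx t).2]
      simp only [Matrix.mulVec_smul, smul_add]

theorem window_mem_behavior {S : LTISystem nx nu ny} {N L : ℕ} {w : ExtTraj nu ny N}
    (hw : w ∈ S.behavior N) (j : Fin (N + 1 - L)) :
    (blockHankel L w).col j ∈ S.behavior L := by
  obtain ⟨x, hx⟩ := hw
  refine ⟨fun t => x ⟨t + j, by omega⟩, fun t => ?_⟩
  have := hx ⟨t + j, by omega⟩
  simp only [Fin.succ_mk, Fin.castSucc_mk] at this
  simp only [Fin.val_succ, Fin.val_castSucc, show (t : ℕ) + 1 + j = t + j + 1 by omega]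
  exact this

/-! ### Reachability and the observable quotient -/

/-- A subspace that contains all reachable directions of a controllable system is everything. -/
theorem IsControllable.eq_top {S : LTISystem nx nu ny} (hS : S.IsControllable)
    (R : Submodule ℝ (Fin nx → ℝ)) (hR : ∀ (i : ℕ) (u : Fin nu → ℝ), S.A ^ i *ᵥ S.B *ᵥ u ∈ R) :
    R = ⊤ := by
  refine (Submodule.eq_top_iff').2 fun b => ?_
  obtain ⟨T, x, u, h0, h1, hx⟩ := hS 0 b
  have key : ∀ t : Fin (T + 1), ∀ k : ℕ, S.A ^ k *ᵥ x t ∈ R := by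
    intro t
    induction t using Fin.induction with
    | zero => intro k; simp [h0]
    | succ t ih =>
      intro k
      rw [hx, Matrix.mulVec_add, Matrix.mulVec_mulVec, ← pow_succ]
      exact R.add_mem (ih _) (hR _ _)
  simpa [h1] using key (Fin.last T) 0

/-- The observability map: a state is sent to its free output response. -/
def freeResponse (S : LTISystem nx nu ny) : (Fin nx → ℝ) →ₗ[ℝ] (ℕ → Fin ny → ℝ) :=
  LinearMap.pi fun t => (S.C * S.A ^ t).mulVecLin

theorem freeResponse_apply (S : LTISystem nx nu ny) (x : Fin nx → ℝ) (t : ℕ) :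
    S.freeResponse x t = (S.C * S.A ^ t) *ᵥ x := rfl

/-- This lets `A` descend to the quotient by unobservable states, where it becomes the left shift.
-/
theorem freeResponse_mulVec (S : LTISystem nx nu ny) (x : Fin nx → ℝ) :
    S.freeResponse (S.A *ᵥ x) = LinearMap.funLeft ℝ (Fin ny → ℝ) Nat.succ (S.freeResponse x) := by
  ext t i
  simp [freeResponse_apply, LinearMap.funLeft_apply, pow_succ, Matrix.mul_assoc]

/-- The shift acting on free responses. -/
def responseShift (S : LTISystem nx nu ny) :
    LinearMap.range S.freeResponse →ₗ[ℝ] LinearMap.range S.freeResponse :=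
  (LinearMap.funLeft ℝ (Fin ny → ℝ) Nat.succ).restrict (by
    rintro _ ⟨x, rfl⟩
    exact ⟨S.A *ᵥ x, S.freeResponse_mulVec x⟩)

theorem responseShift_rangeRestrict (S : LTISystem nx nu ny) (x : Fin nx → ℝ) :
    S.responseShift (S.freeResponse.rangeRestrict x) =
      S.freeResponse.rangeRestrict (S.A *ᵥ x) :=
  Subtype.ext (S.freeResponse_mulVec x).symm

theorem responseShift_pow_rangeRestrict (S : LTISystem nx nu ny) (i : ℕ) (x : Fin nx → ℝ) :
    (S.responseShift ^ i) (S.freeResponse.rangeRestrict x) =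
      S.freeResponse.rangeRestrict (S.A ^ i *ᵥ x) := by
  induction i with
  | zero => simp
  | succ i ih =>
    rw [pow_succ', Module.End.mul_apply, ih, responseShift_rangeRestrict, Matrix.mulVec_mulVec,
      ← pow_succ']

/-- The observable part of a controllable system is no larger than its McMillan degree. -/
theorem IsControllable.finrank_range_freeResponse_le {S : LTISystem nx nu ny}
    (hS : S.IsControllable) :
    Module.finrank ℝ (LinearMap.range S.freeResponse) ≤ S.mcMillanDegree := by
  obtain ⟨S', -, hS'⟩ : ∃ S' : LTISystem S.mcMillanDegree nu ny, S'.Realizes S :=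
    Nat.sInf_mem (s := {k : ℕ | ∃ S' : LTISystem k nu ny, S'.Realizes S})
      ⟨nx, S, rfl, fun _ => rfl⟩
  have hle : LinearMap.range S.freeResponse ≤ LinearMap.range S'.freeResponse := by
    -- Equal Markov parameters give `Aⁱ B u` the same free response in both realizations, and such
    -- states span.
    have htop := hS.eq_top ((LinearMap.range S'.freeResponse).comap S.freeResponse) (by
      intro i u
      refine ⟨S'.A ^ i *ᵥ S'.B *ᵥ u, ?_⟩
      ext1 t
      have := hS' (t + i)
      simp only [pow_add, ← Matrix.mul_assoc] at this
      simp only [freeResponse_apply, Matrix.mulVec_mulVec, ← Matrix.mul_assoc, this])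
    rintro _ ⟨x, rfl⟩
    have hx : x ∈ (LinearMap.range S'.freeResponse).comap S.freeResponse :=
      htop ▸ Submodule.mem_top
    exact hx
  calc _ ≤ Module.finrank ℝ (LinearMap.range S'.freeResponse) := Submodule.finrank_mono hle
    _ ≤ Module.finrank ℝ (Fin S.mcMillanDegree → ℝ) := LinearMap.finrank_range_le _
    _ = _ := by simp

/-! ### The fundamental lemma -/

/-- Willems' fundamental lemma, with the order of excitation governed by the McMillan degree. -/
theorem IsControllable.behavior_eq_columnSpace {S : LTISystem nx nu ny} (hS : S.IsControllable)
    {L N n : ℕ} {wd : ExtTraj nu ny N} (hwd : wd ∈ S.behavior N) (hn : S.mcMillanDegree ≤ n)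
    (hPE : PersistentlyExciting wd.input (L + n)) :
    S.behavior L = columnSpace (blockHankel L wd) := by
  apply Set.Subset.antisymm
  · intro w hw
    obtain ⟨x, hx⟩ := (S.mem_behavior_iff w).1 hw
    obtain ⟨xd, hxd⟩ := (S.mem_behavior_iff wd).1 hwd
    have hctrl : ∀ ξ : LinearMap.range S.freeResponse →ₗ[ℝ] ℝ, (∀ i : ℕ, ∀ u,
        ξ ((S.responseShift ^ i) ((S.freeResponse.rangeRestrict ∘ₗ S.B.mulVecLin) u)) = 0) →
        ξ = 0 := by
      intro ξ hξ
      have htop := hS.eq_top (LinearMap.ker (ξ ∘ₗ S.freeResponse.rangeRestrict)) (by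
        intro i u
        have := hξ i u
        rwa [LinearMap.comp_apply, responseShift_pow_rangeRestrict] at this)
      rw [LinearMap.ker_eq_top] at htop
      ext ⟨_, y, rfl⟩
      exact congrArg (fun f : (Fin nx → ℝ) →ₗ[ℝ] ℝ => f y) htop
    obtain ⟨g, hg0, hgu⟩ := exists_state_input_combination S.responseShift
      (S.freeResponse.rangeRestrict ∘ₗ S.B.mulVecLin) hctrl
      (hS.finrank_range_freeResponse_le.trans hn)
      (fun t => S.freeResponse.rangeRestrict (xd t)) (signalAt wd.input)
      (by
        intro t ht
        rw [(hxd t ht).1, map_add, responseShift_rangeRestrict]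
        rfl)
      hPE.functional_eq_zero (S.freeResponse.rangeRestrict (x 0))
      (fun i => signalAt w.input i)
    have hstate : ∀ t ≤ L, ∑ j : Fin (N + 1 - L), g j •
        S.freeResponse.rangeRestrict (xd (j + t)) = S.freeResponse.rangeRestrict (x t) := by
      intro t
      induction t with
      | zero => intro _; simpa using hg0
      | succ t ih =>
        intro ht
        rw [(hx t (by omega)).1, map_add, ← responseShift_rangeRestrict, ← ih (by omega),
          ← hgu ⟨t, by omega⟩, map_sum, ← Matrix.mulVecLin_apply, map_sum, map_sum,
          ← Finset.sum_add_distrib]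
        refine Finset.sum_congr rfl fun j _ => ?_
        rw [← add_assoc, (hxd (j + t) (by omega)).1, map_add, smul_add, map_smul, map_smul,
          map_smul, responseShift_rangeRestrict, Matrix.mulVecLin_apply]
    -- The free response at time 0 is `C x`, so outputs depend only on the observable class of the
    -- state.
    have hC : ∀ t ≤ L, ∑ j : Fin (N + 1 - L), g j • S.C *ᵥ xd (j + t) = S.C *ᵥ x t := by
      intro t ht
      have := congrFun (congrArg Subtype.val (hstate t ht)) 0
      simpa [freeResponse_apply] using this
    have hout : ∀ t < L, ∑ j : Fin (N + 1 - L), g j • signalAt wd.output (j + t) =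
        signalAt w.output t := by
      intro t ht
      rw [(hx t ht).2, ← hC t ht.le, ← hgu ⟨t, ht⟩, ← Matrix.mulVecLin_apply S.D, map_sum,
        ← Finset.sum_add_distrib]
      refine Finset.sum_congr rfl fun j _ => ?_
      rw [(hxd (j + t) (by omega)).2, smul_add, map_smul, Matrix.mulVecLin_apply]
    refine (mem_columnSpace_iff _ _).2 ⟨g, ?_⟩
    ext ⟨t, i⟩
    rw [blockHankel_mulVec_apply]
    cases i with
    | inl i =>
      have := congrFun (hgu t) i
      rw [signalAt_apply _ t.2] at this
      simpa [signalAt, ExtTraj.input] using this.symm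
    | inr i =>
      have := congrFun (hout t t.2) i
      rw [signalAt_apply _ t.2] at this
      simpa [signalAt, ExtTraj.output] using this.symm
  · have : columnSpace (blockHankel L wd) ≤ S.behaviorSubmodule L := by
      refine Submodule.span_le.2 ?_
      rintro _ ⟨j, rfl⟩
      exact window_mem_behavior hwd j
    exact this

/-! ### Moments and affine hull -/

/-- The degree-one moments of the behavioral measures are exactly the trajectories. -/
theorem degreeOneMomentSet_eq (S : LTISystem nx nu ny) (L : ℕ) :
    S.degreeOneMomentSet L = ({1} : Set ℝ) ×ˢ S.behavior L := by
  have hclosed : IsClosed (S.behavior L) := (S.behaviorSubmodule L).closed_of_finiteDimensional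
  ext ⟨a, w⟩
  constructor
  · rintro ⟨μ, ⟨hprob, hsupp, hfin⟩, hμ⟩
    simp only [degreeOneMoment, Prod.mk.injEq] at hμ
    obtain ⟨rfl, rfl⟩ := hμ
    refine ⟨rfl, ?_⟩
    have hae : ∀ᵐ w ∂μ, w ∈ S.behavior L :=
      (prob_compl_eq_zero_iff hclosed.measurableSet).2 hsupp
    exact (S.behaviorSubmodule L).convex.integral_mem hclosed hae
      ⟨aestronglyMeasurable_id, hfin⟩
  · rintro ⟨ha, hw⟩
    rw [Set.mem_singleton_iff] at ha
    dsimp only at ha hw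
    subst ha
    refine ⟨Measure.dirac w, ⟨inferInstance, ?_, ?_⟩, ?_⟩
    · rw [Measure.dirac_apply' _ hclosed.measurableSet]
      simp [hw]
    · rw [lintegral_dirac]
      exact enorm_lt_top
    · simp [degreeOneMoment]

end LTISystem

theorem affineSpan_singleton_prod_submodule {E : Type*} [AddCommGroup E] [Module ℝ E]
    (P : Submodule ℝ E) :
    (affineSpan ℝ (({1} : Set ℝ) ×ˢ (P : Set E)) : Set (ℝ × E)) = ({1} : Set ℝ) ×ˢ (P : Set E) := by
  have h : (AffineSubspace.mk' ((1 : ℝ), (0 : E)) ((⊥ : Submodule ℝ ℝ).prod P) : Set (ℝ × E)) =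
      ({1} : Set ℝ) ×ˢ (P : Set E) := by
    ext ⟨a, v⟩
    simp [AffineSubspace.mem_mk', Submodule.mem_prod, sub_eq_zero]
  rw [← h, AffineSubspace.affineSpan_coe]

theorem mainTheorem12 {nx nu ny : ℕ} (S : LTISystem nx nu ny) (hS : S.IsControllable)
    (L N : ℕ) (wd : ExtTraj nu ny N) (hwd : wd ∈ S.behavior N)
    (nbar : ℕ) (hnbar : S.mcMillanDegree ≤ nbar)
    (hPE : PersistentlyExciting (ExtTraj.input wd) (L + nbar)) :
    S.degreeOneMomentSet L =
        ({1} : Set ℝ) ×ˢ (columnSpace (blockHankel L wd) : Set (ExtTraj nu ny L)) ∧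
    (affineSpan ℝ (S.degreeOneMomentSet L) : Set (ℝ × ExtTraj nu ny L)) =
        {v | ∃ g : Fin (N + 1 - L) → ℝ, v = (1, blockHankel L wd *ᵥ g)} ∧
    {v : ℝ × ExtTraj nu ny L | ∃ g : Fin (N + 1 - L) → ℝ, v = (1, blockHankel L wd *ᵥ g)} =
        ({1} : Set ℝ) ×ˢ (columnSpace (blockHankel L wd) : Set (ExtTraj nu ny L)) := by

  have hset : {v : ℝ × ExtTraj nu ny L | ∃ g : Fin (N + 1 - L) → ℝ,
      v = (1, blockHankel L wd *ᵥ g)} =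
        ({1} : Set ℝ) ×ˢ (columnSpace (blockHankel L wd) : Set (ExtTraj nu ny L)) := by
    ext ⟨a, v⟩
    simp [mem_columnSpace_iff]
  have hmom := S.degreeOneMomentSet_eq L
  rw [hS.behavior_eq_columnSpace hwd hnbar hPE] at hmom
  exact ⟨hmom, by rw [hmom, hset, affineSpan_singleton_prod_submodule], hset⟩
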